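/- Let $b>1$ be an odd integer and let $\mathcal A=\{1<b\}$. For an infinite word $w\in\mathcal A^\omega$ that is not eventually constant, let $\Delta(w)\in\mathbb N^\omega$ be its run-length encoding, i.e. the sequence of the lengths of its successive maximal blocks of equal letters. An infinite word $w$ is smooth over $\mathcal A$ if for every $k\ge 0$ the iterate $\Delta^k(w)$ is defined and is an infinite word over $\mathcal A$ that is not eventually constant; for such $w$ put $\Phi(w)=\Delta^0(w)[0]\,\Delta^1(w)[0]\,\Delta^2(w)[0]\cdots\in\mathcal A^\omega$, where $u[0]$ is the first letter of $u$. An infinite word is an infinite Lyndon word if it is strictly smaller, in the lexicographic order, than each of its proper suffixes. Then there is a lexicographically smallest infinite smooth word $m_{\{1<b\}}$ over $\mathcal A$; it is the unique infinite smooth word $w$ over $\mathcal A$ with $\Phi(w)=(1b)^\omega=1b1b1b\cdots$; and it is the unique infinite word $w$ that is smooth over $\mathcal A$, is an infinite Lyndon word, and is such that $\Phi(w)$ begins with $1b$. -/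

import Mathlib

/-- A right infinite word over the natural numbers; `w i` is its `(i+1)`-th letter. -/
abbrev InfiniteWord : Type := ℕ → ℕ

namespace InfiniteWord

/-- Position `n` of `w` is the first position of a block (a maximal run of equal letters). -/
def IsBlockStart (w : InfiniteWord) (n : ℕ) : Prop :=
  n = 0 ∨ w n ≠ w (n - 1)

/-- `w` is a product of infinitely many (finite) blocks, i.e. it is not eventually constant. -/
def HasInfinitelyManyBlocks (w : InfiniteWord) : Prop :=
  {n : ℕ | IsBlockStart w n}.Infinite

open Classical in
/-- The run-length encoding `Δ`: its letter at `i` is the length of the block number `i` of `w`,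
counted from `0`. It is meaningful for words with infinitely many blocks. -/
noncomputable def runLength (w : InfiniteWord) : InfiniteWord :=
  fun i => Nat.nth (IsBlockStart w) (i + 1) - Nat.nth (IsBlockStart w) i

/-- The set of infinite smooth words over the alphabet `{a < b}`: all iterates `Δ^k(w)` are
defined and are infinite words over `{a, b}`. -/
def IsSmooth (a b : ℕ) (w : InfiniteWord) : Prop :=
  ∀ k : ℕ, HasInfinitelyManyBlocks (runLength^[k] w) ∧
    ∀ n : ℕ, (runLength^[k] w) n = a ∨ (runLength^[k] w) n = b

/-- The word `Φ(w) = Δ^0(w)[0] Δ^1(w)[0] Δ^2(w)[0] ⋯`. -/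
noncomputable def Phi (w : InfiniteWord) : InfiniteWord :=
  fun i => (runLength^[i] w) 0

/-- Infinite Lyndon words: strictly smaller, for the lexicographic order, than all of their
proper suffixes. -/
def IsLyndon (w : InfiniteWord) : Prop :=
  ∀ n : ℕ, 0 < n → toLex w < toLex (fun i => w (n + i))

/-- `m` is the smallest infinite smooth word over `{a < b}` for the lexicographic order. -/
def IsMinimalSmooth (a b : ℕ) (m : InfiniteWord) : Prop :=
  IsSmooth a b m ∧ ∀ w : InfiniteWord, IsSmooth a b w → toLex m ≤ toLex w

/-- The periodic word `(ab)^ω = ababab⋯`. -/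
def alternating (a b : ℕ) : InfiniteWord :=
  fun i => if Even i then a else b

end InfiniteWord

/-! Let `D = doubleExpand b`. A smooth word `w` with `Φ(w)` starting with `1b` is recovered from its
second iterate as `w = D (Δ² w)`. Since `D` turns agreement on `n` letters into agreement on `n +
1`, it has a fixed point `m` (`exists_doubleExpand_eq_self`), and any class of words closed under
inverting `D` is contained in `{m}` (`eq_of_doubleExpand_invariant`). This settles the
characterization by `Φ`.

Oddness of `b` enters through parity: all block lengths are odd, so block `i` starts at a position
of the parity of `i` (`even_blockPos`). Hence the two expansions in `D` both keep or both reverse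
the order, and `D` is strictly increasing. Minimality follows by descent: a smooth `w < m` must
start with `11`, so `w = D v` with `v < m` differing from `m` strictly earlier.

For the Lyndon part, `m` has `1` at all even positions, so a suffix of `m` starting with a full
block `1^b` is `D` of an earlier suffix of `m`, and induction applies. Conversely, if `D v` is
Lyndon and smooth, so is `v`, and `Φ(v)` again starts with `1b`. The delicate case `Φ(v) = 11⋯`
would force `Δ v = m`, which `exists_update_shift_expand_lt` excludes. -/

namespace InfiniteWord

/-! ### Words with prescribed block lengths -/

/-- The `n`-th letter of `1b1b1b⋯`. -/
def letter (b n : ℕ) : ℕ := if Even n then 1 else b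

/-- The suffix of `w` starting at position `n`. -/
def shift (n : ℕ) (w : InfiniteWord) : InfiniteWord := fun i => w (n + i)

/-- The starting position of the block number `i` when the block lengths are given by `u`. -/
def blockPos (u : InfiniteWord) (i : ℕ) : ℕ := ∑ k ∈ Finset.range i, u k

/-- The number of the block that contains position `n` when the block lengths are given by `u`. -/
def blockIndex (u : InfiniteWord) (n : ℕ) : ℕ := Nat.findGreatest (fun i => blockPos u i ≤ n) n

/-- The word with block lengths `u` whose block number `i` is made of the letter
`letter b (p + i)`. -/
def expand (b p : ℕ) (u : InfiniteWord) : InfiniteWord := fun n => letter b (p + blockIndex u n)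

/-- All letters of `w` are `1` or `b`. -/
def IsOver (b : ℕ) (w : InfiniteWord) : Prop := ∀ n, w n = 1 ∨ w n = b

/-- `x` and `y` first differ at position `k`, where `x` is smaller. -/
def LTAt (k : ℕ) (x y : InfiniteWord) : Prop := (∀ i < k, x i = y i) ∧ x k < y k

variable {b : ℕ} {u v w m : InfiniteWord}

lemma toLex_lt_iff : toLex u < toLex v ↔ ∃ k, LTAt k u v := Iff.rfl

lemma letter_add_even (p : ℕ) {i : ℕ} (hi : Even i) : letter b (p + i) = letter b p := by
  simp only [letter, Nat.even_add, hi, iff_true]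

lemma letter_of_even {n : ℕ} (hn : Even n) : letter b n = 1 := if_pos hn

lemma letter_of_odd {n : ℕ} (hn : ¬ Even n) : letter b n = b := if_neg hn

lemma letter_succ_ne (hb : 1 < b) (n : ℕ) : letter b (n + 1) ≠ letter b n := by
  unfold letter
  by_cases h : Even n <;> simp [Nat.even_add_one, h] <;> omega

lemma even_of_letter_eq_one (hb : 1 < b) {n : ℕ} (h : letter b n = 1) : Even n := by
  by_contra hn
  rw [letter_of_odd hn] at h
  omega

lemma odd_of_letter_eq (hb : 1 < b) {n : ℕ} (h : letter b n = b) : ¬ Even n := by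
  intro hn
  rw [letter_of_even hn] at h
  omega

lemma isOver_expand (b p : ℕ) (u : InfiniteWord) : IsOver b (expand b p u) := by
  intro n
  unfold expand letter
  split_ifs <;> simp

lemma IsOver.pos (h : IsOver b u) (hb : 1 < b) (n : ℕ) : 0 < u n := by
  rcases h n with h | h <;> omega

lemma IsOver.shift (h : IsOver b u) (n : ℕ) : IsOver b (shift n u) := fun i => h (n + i)

lemma IsOver.update_one (h : IsOver b u) : IsOver b (Function.update u 0 1) := by
  intro n
  rcases n with _ | n
  · simp
  · simpa using h (n + 1)

@[simp] lemma blockPos_zero (u : InfiniteWord) : blockPos u 0 = 0 := rfl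

lemma blockPos_succ (u : InfiniteWord) (i : ℕ) : blockPos u (i + 1) = blockPos u i + u i :=
  Finset.sum_range_succ _ _

lemma blockPos_one (u : InfiniteWord) : blockPos u 1 = u 0 := by
  simp [blockPos_succ]

lemma strictMono_blockPos (hu : ∀ n, 0 < u n) : StrictMono (blockPos u) := by
  refine strictMono_nat_of_lt_succ fun n => ?_
  rw [blockPos_succ]
  exact Nat.lt_add_of_pos_right (hu n)

lemma le_blockPos (hu : ∀ n, 0 < u n) (n : ℕ) : n ≤ blockPos u n :=
  (strictMono_blockPos hu).le_apply

lemma blockPos_congr {n : ℕ} (h : ∀ i < n, u i = v i) : blockPos u n = blockPos v n :=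
  Finset.sum_congr rfl fun i hi => h i (Finset.mem_range.1 hi)

lemma even_blockPos (hodd : Odd b) (hu : IsOver b u) (i : ℕ) : Even (blockPos u i) ↔ Even i := by
  induction i with
  | zero => simp
  | succ i ih =>
    have : ¬ Even (u i) := by
      rcases hu i with h | h <;> rw [h]
      · simp
      · simpa using hodd
    rw [blockPos_succ, Nat.even_add, ih, Nat.even_add_one]
    tauto

lemma lt_blockPos (hb : 1 < b) (hu : IsOver b u) (h0 : u 0 = b) {n : ℕ} (hn : 0 < n) :
    n < blockPos u n := by
  induction n, hn using Nat.le_induction with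
  | base => rw [blockPos_one, h0]; exact hb
  | succ n _ ih =>
    have := hu.pos hb n
    rw [blockPos_succ]
    omega

lemma exists_block (hu : ∀ n, 0 < u n) (n : ℕ) : ∃ i, ∃ r < u i, n = blockPos u i + r := by
  induction n with
  | zero => exact ⟨0, 0, hu 0, rfl⟩
  | succ n ih =>
    obtain ⟨i, r, hr, rfl⟩ := ih
    by_cases h : r + 1 < u i
    · exact ⟨i, r + 1, h, rfl⟩
    · refine ⟨i + 1, 0, hu _, ?_⟩
      rw [blockPos_succ]
      omega

lemma blockIndex_eq (hu : ∀ n, 0 < u n) {i r : ℕ} (hr : r < u i) :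
    blockIndex u (blockPos u i + r) = i := by
  unfold blockIndex
  rw [Nat.findGreatest_eq_iff]
  -- Positive lengths give `i ≤ blockPos u i`, so the search bound in `blockIndex` cuts nothing off.
  refine ⟨(le_blockPos hu i).trans (Nat.le_add_right _ _), fun _ => Nat.le_add_right _ _, ?_⟩
  intro n hn _ h
  have := (strictMono_blockPos hu).monotone (Nat.succ_le_of_lt hn)
  rw [Nat.succ_eq_add_one, blockPos_succ] at this
  omega

lemma expand_apply (b p : ℕ) (hu : ∀ n, 0 < u n) {i r : ℕ} (hr : r < u i) :
    expand b p u (blockPos u i + r) = letter b (p + i) := by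
  rw [expand, blockIndex_eq hu hr]

lemma expand_blockPos (b p : ℕ) (hu : ∀ n, 0 < u n) (i : ℕ) :
    expand b p u (blockPos u i) = letter b (p + i) :=
  expand_apply b p hu (hu i)

lemma expand_of_lt (b p : ℕ) (hu : ∀ n, 0 < u n) {r : ℕ} (hr : r < u 0) :
    expand b p u r = letter b p := by
  simpa using expand_apply b p hu hr

lemma expand_zero (b p : ℕ) (hu : ∀ n, 0 < u n) : expand b p u 0 = letter b p :=
  expand_of_lt b p hu (hu 0)

lemma eq_expand (p : ℕ) (hu : ∀ n, 0 < u n)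
    (h : ∀ i, ∀ r < u i, w (blockPos u i + r) = letter b (p + i)) : w = expand b p u := by
  funext n
  obtain ⟨i, r, hr, rfl⟩ := exists_block hu n
  rw [h i r hr, expand_apply b p hu hr]

lemma expand_add_even (p : ℕ) {i : ℕ} (hi : Even i) : expand b (p + i) u = expand b p u := by
  funext n
  rw [expand, expand, Nat.add_right_comm, letter_add_even _ hi]

lemma blockPos_update_shift {i r : ℕ} (hr : r < u i) (k : ℕ) :
    blockPos u i + r + blockPos (Function.update (shift i u) 0 (u i - r)) (k + 1) =
      blockPos u (i + (k + 1)) := by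
  induction k with
  | zero => rw [blockPos_one, blockPos_succ, Function.update_self]; omega
  | succ k ih =>
    rw [blockPos_succ, ← add_assoc, ih, ← add_assoc i (k + 1), blockPos_succ,
      Function.update_of_ne (by omega)]
    rfl

/-- Cutting inside block `i` shortens only that block; the later blocks keep their lengths and
letters. -/
lemma shift_expand_add (p : ℕ) (hu : ∀ n, 0 < u n) {i r : ℕ} (hr : r < u i) :
    shift (blockPos u i + r) (expand b p u) =
      expand b (p + i) (Function.update (shift i u) 0 (u i - r)) := by
  apply eq_expand
  · intro n
    rcases n with _ | n
    · simpa using hr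
    · rw [Function.update_of_ne (by omega)]
      exact hu _
  · intro k s hs
    rcases k with _ | k
    · rw [Function.update_self] at hs
      rw [blockPos_zero, zero_add, shift, add_assoc, expand_apply b p hu (by omega), add_zero]
    · rw [Function.update_of_ne (by omega)] at hs
      rw [shift, ← add_assoc, blockPos_update_shift hr, expand_apply b p hu hs, add_assoc]

lemma shift_expand (p : ℕ) (hu : ∀ n, 0 < u n) (i : ℕ) :
    shift (blockPos u i) (expand b p u) = expand b (p + i) (shift i u) := by
  have h := shift_expand_add (b := b) p hu (hu i)
  have h' : u i - 0 = shift i u 0 := rfl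
  rwa [h', Function.update_eq_self, add_zero] at h

lemma expand_congr (p : ℕ) (hu : ∀ n, 0 < u n) (hv : ∀ n, 0 < v n) {n : ℕ}
    (h : ∀ i < n, u i = v i) {k : ℕ} (hk : k < blockPos u n) :
    expand b p u k = expand b p v k := by
  obtain ⟨i, r, hr, rfl⟩ := exists_block hu k
  have hi : i < n := by
    by_contra hi
    have := (strictMono_blockPos hu).monotone (not_lt.1 hi)
    omega
  rw [expand_apply b p hu hr, blockPos_congr fun j hj => h j (hj.trans hi),
    expand_apply b p hv (h i hi ▸ hr)]

/-! ### Expansion and run-length encoding -/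

lemma isBlockStart_expand (hb : 1 < b) (p : ℕ) (hu : ∀ n, 0 < u n) {n : ℕ} :
    IsBlockStart (expand b p u) n ↔ n ∈ Set.range (blockPos u) := by
  obtain ⟨i, r, hr, rfl⟩ := exists_block hu n
  constructor
  · rintro (h | h)
    · exact ⟨0, h.symm⟩
    · rcases r with _ | r
      · exact ⟨i, rfl⟩
      · rw [expand_apply b p hu hr, ← add_assoc, Nat.add_sub_cancel,
          expand_apply b p hu (by omega)] at h
        exact absurd rfl h
  · rintro ⟨j, hj⟩
    rw [← hj]
    rcases j with _ | j
    · exact Or.inl rfl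
    · right
      have := hu j
      rw [expand_blockPos b p hu, blockPos_succ, Nat.add_sub_assoc (by omega),
        expand_apply b p hu (by omega)]
      exact letter_succ_ne hb _

lemma hasInfinitelyManyBlocks_expand (hb : 1 < b) (p : ℕ) (hu : ∀ n, 0 < u n) :
    HasInfinitelyManyBlocks (expand b p u) := by
  have : {n | IsBlockStart (expand b p u) n} = Set.range (blockPos u) :=
    Set.ext fun n => isBlockStart_expand hb p hu
  rw [HasInfinitelyManyBlocks, this]
  exact Set.infinite_range_of_injective (strictMono_blockPos hu).injective

lemma nth_isBlockStart_expand (hb : 1 < b) (p : ℕ) (hu : ∀ n, 0 < u n) (i : ℕ) :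
    Nat.nth (IsBlockStart (expand b p u)) i = blockPos u i := by
  have hT : (fun n => IsBlockStart (expand b p u) (blockPos u n)) = fun _ => True := by
    funext n
    simpa using (isBlockStart_expand hb p hu).2 ⟨n, rfl⟩
  have h := Nat.nth_comp_of_strictMono (p := IsBlockStart (expand b p u)) (n := i)
    (strictMono_blockPos hu) (fun k hk => (isBlockStart_expand hb p hu).1 hk)
    (fun hf => absurd hf (hasInfinitelyManyBlocks_expand hb p hu))
  rw [← h, hT, Nat.nth_true]

lemma runLength_expand (hb : 1 < b) (p : ℕ) (hu : ∀ n, 0 < u n) :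
    runLength (expand b p u) = u := by
  funext i
  rw [runLength, nth_isBlockStart_expand hb p hu, nth_isBlockStart_expand hb p hu, blockPos_succ]
  omega

lemma eq_expand_runLength (hw : HasInfinitelyManyBlocks w) (hover : IsOver b w) {p : ℕ}
    (hp : w 0 = letter b p) : w = expand b p (runLength w) := by
  set q := Nat.nth (IsBlockStart w)
  have hmono : StrictMono q := Nat.nth_strictMono hw
  have hpos : ∀ n, 0 < runLength w n := fun n => Nat.sub_pos_of_lt (hmono (Nat.lt_succ_self n))
  have hS : ∀ i, blockPos (runLength w) i = q i := by
    intro i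
    induction i with
    | zero => exact (Nat.nth_zero_of_zero (Or.inl rfl)).symm
    | succ i ih =>
      have h := hmono (Nat.lt_succ_self i)
      have h' : runLength w i = q (i + 1) - q i := rfl
      rw [blockPos_succ, ih, h']
      simp only [Nat.succ_eq_add_one] at h
      omega
  have hconst : ∀ i r, q i + r < q (i + 1) → w (q i + r) = w (q i) := by
    intro i r
    induction r with
    | zero => intro _; rfl
    | succ r ih =>
      intro h
      rw [← ih (by omega)]
      by_contra hne
      -- A change of letter here would be a block start strictly between two consecutive ones.
      have hst : IsBlockStart w (q i + (r + 1)) := Or.inr hne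
      obtain ⟨j, hj⟩ := Nat.exists_lt_card_nth_eq hst
      have hqj : q j = q i + (r + 1) := hj.2
      have h1 : j < i + 1 := hmono.lt_iff_lt.1 (hqj ▸ h)
      have h2 : i < j := hmono.lt_iff_lt.1 (by omega)
      omega
  have hletter : ∀ i, w (q i) = letter b (p + i) := by
    intro i
    induction i with
    | zero => rw [← hS, blockPos_zero]; exact hp
    | succ i ih =>
      have hlt : q i < q (i + 1) := hmono (Nat.lt_succ_self i)
      have hst : IsBlockStart w (q (i + 1)) := Nat.nth_mem_of_infinite hw _
      have hne : w (q (i + 1)) ≠ w (q (i + 1) - 1) := hst.resolve_left (by omega)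
      have hc := hconst i (q (i + 1) - 1 - q i) (by omega)
      rw [Nat.add_sub_of_le (by omega), ih] at hc
      rw [hc] at hne
      have ho := hover (q (i + 1))
      rw [← add_assoc]
      unfold letter at hne ⊢
      by_cases he : Even (p + i)
      · simp only [he, if_true, Nat.even_add_one, not_true, if_false] at hne ⊢
        tauto
      · simp only [he, if_false, Nat.even_add_one, not_false_eq_true, if_true] at hne ⊢
        tauto
  refine eq_expand p hpos fun i r hr => ?_
  rw [hS, hconst i r, hletter]
  change r < q (i + 1) - q i at hr
  omega

lemma IsSmooth.isOver (h : IsSmooth 1 b w) : IsOver b w := (h 0).2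

lemma IsSmooth.runLength (h : IsSmooth 1 b w) : IsSmooth 1 b (runLength w) := fun k => h (k + 1)

lemma IsSmooth.eq_expand (h : IsSmooth 1 b w) {p : ℕ} (hp : w 0 = letter b p) :
    w = expand b p (InfiniteWord.runLength w) :=
  eq_expand_runLength (h 0).1 h.isOver hp

/-! ### The double expansion -/

/-- The word `w` with `Φ(w) = 1bΦ(v)`. -/
def doubleExpand (b : ℕ) (v : InfiniteWord) : InfiniteWord := expand b 0 (expand b 1 v)

lemma expand_pos (hb : 1 < b) (p : ℕ) (u : InfiniteWord) (n : ℕ) : 0 < expand b p u n :=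
  (isOver_expand b p u).pos hb n

lemma expand_one_zero (hb : 1 < b) (hv : IsOver b v) : expand b 1 v 0 = b := by
  rw [expand_zero b 1 (hv.pos hb), letter_of_odd (by simp)]

lemma doubleExpand_of_lt (hb : 1 < b) (hv : IsOver b v) {r : ℕ} (hr : r < b) :
    doubleExpand b v r = 1 := by
  rw [doubleExpand, expand_of_lt b 0 (expand_pos hb 1 v) (by rwa [expand_one_zero hb hv]),
    letter_of_even (by simp)]

lemma runLength_doubleExpand (hb : 1 < b) (v : InfiniteWord) :
    runLength (doubleExpand b v) = expand b 1 v :=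
  runLength_expand hb 0 (expand_pos hb 1 v)

/-- The extra letter comes from the intermediate word starting with `b > 1`: its first `n` entries,
for `n > 0`, sum to more than `n`. -/
lemma doubleExpand_congr (hb : 1 < b) (hu : IsOver b u) (hv : IsOver b v) {n : ℕ}
    (h : ∀ i < n, u i = v i) {k : ℕ} (hk : k < n + 1) :
    doubleExpand b u k = doubleExpand b v k := by
  rcases n with _ | n
  · rw [doubleExpand_of_lt hb hu (by omega), doubleExpand_of_lt hb hv (by omega)]
  · have h1 := le_blockPos (hu.pos hb) (n + 1)
    have h2 := lt_blockPos hb (isOver_expand b 1 u) (expand_one_zero hb hu) (n := n + 1) (by omega)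
    exact expand_congr 0 (expand_pos hb 1 u) (expand_pos hb 1 v) (n := n + 1)
      (fun i hi => expand_congr 1 (hu.pos hb) (hv.pos hb) h (by omega)) (by omega)

/-- Where two expansions differ, given where the words of block lengths do. -/
lemma LTAt.expand_differ (hb : 1 < b) (hu : IsOver b u) (hv : IsOver b v) (p : ℕ) {k : ℕ}
    (h : LTAt k u v) :
    (∀ i < blockPos u k + 1, expand b p u i = expand b p v i) ∧
      expand b p u (blockPos u k + 1) = letter b (p + k + 1) ∧
      expand b p v (blockPos u k + 1) = letter b (p + k) := by
  obtain ⟨heq, hlt⟩ := h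
  -- Block `k` starts at the same place in both words, but ends after one letter for `u` only, so
  -- the next position separates them.
  have hu1 : u k = 1 := by rcases hu k with h | h <;> rcases hv k with h' | h' <;> omega
  have hv1 : v k = b := by rcases hu k with h | h <;> rcases hv k with h' | h' <;> omega
  have hS := blockPos_congr heq
  refine ⟨fun i hi => ?_, ?_, ?_⟩
  · rcases Nat.lt_succ_iff_lt_or_eq.1 hi with hi | rfl
    · exact expand_congr p (hu.pos hb) (hv.pos hb) heq hi
    · rw [expand_blockPos b p (hu.pos hb), hS, expand_blockPos b p (hv.pos hb)]
  · have := expand_blockPos b p (hu.pos hb) (k + 1)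
    rwa [blockPos_succ, hu1, ← add_assoc] at this
  · rw [hS, expand_apply b p (hv.pos hb) (by omega)]

lemma LTAt.expand_of_odd (hb : 1 < b) (hu : IsOver b u) (hv : IsOver b v) {p k : ℕ}
    (h : LTAt k u v) (hk : ¬ Even (p + k)) :
    LTAt (blockPos u k + 1) (expand b p u) (expand b p v) := by
  obtain ⟨h1, h2, h3⟩ := h.expand_differ hb hu hv p
  refine ⟨h1, ?_⟩
  rw [h2, h3, letter_of_odd hk, letter_of_even (by rwa [Nat.even_add_one])]
  exact hb

lemma LTAt.expand_of_even (hb : 1 < b) (hu : IsOver b u) (hv : IsOver b v) {p k : ℕ}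
    (h : LTAt k u v) (hk : Even (p + k)) :
    LTAt (blockPos u k + 1) (expand b p v) (expand b p u) := by
  obtain ⟨h1, h2, h3⟩ := h.expand_differ hb hu hv p
  refine ⟨fun i hi => (h1 i hi).symm, ?_⟩
  rw [h2, h3, letter_of_even hk, letter_of_odd (by rwa [Nat.even_add_one, not_not])]
  exact hb

/-- For odd `b`, the double expansion is strictly increasing. -/
lemma LTAt.doubleExpand (hb : 1 < b) (hodd : Odd b) (hu : IsOver b u) (hv : IsOver b v) {k : ℕ}
    (h : LTAt k u v) : ∃ l, k < l ∧ LTAt l (doubleExpand b u) (doubleExpand b v) := by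
  have hk := le_blockPos (hu.pos hb) k
  -- The first difference moves to a position of parity opposite to `k`. As the expansions start
  -- with different letters, both preserve the order for even `k` and both reverse it for odd `k`.
  by_cases he : Even k
  · have h1 := h.expand_of_odd hb hu hv (p := 1) (by simpa [Nat.even_add] using he)
    have h2 := h1.expand_of_odd hb (isOver_expand b 1 u) (isOver_expand b 1 v) (p := 0)
      (by rw [zero_add, Nat.even_add_one, even_blockPos hodd hu]; simpa using he)
    have := le_blockPos (expand_pos hb 1 u) (blockPos u k + 1)
    exact ⟨_, by omega, h2⟩
  · have h1 := h.expand_of_even hb hu hv (p := 1) (by simpa [Nat.even_add] using he)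
    have h2 := h1.expand_of_even hb (isOver_expand b 1 v) (isOver_expand b 1 u) (p := 0)
      (by rw [zero_add, Nat.even_add_one, even_blockPos hodd hu]; exact he)
    have := le_blockPos (expand_pos hb 1 v) (blockPos u k + 1)
    exact ⟨_, by omega, h2⟩

lemma toLex_doubleExpand_lt (hb : 1 < b) (hodd : Odd b) (hu : IsOver b u) (hv : IsOver b v)
    (h : toLex u < toLex v) : toLex (doubleExpand b u) < toLex (doubleExpand b v) := by
  obtain ⟨k, hk⟩ := toLex_lt_iff.1 h
  obtain ⟨l, -, hl⟩ := hk.doubleExpand hb hodd hu hv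
  exact ⟨l, hl⟩

lemma toLex_lt_of_doubleExpand_lt (hb : 1 < b) (hodd : Odd b) (hu : IsOver b u)
    (hv : IsOver b v) (h : toLex (doubleExpand b u) < toLex (doubleExpand b v)) :
    toLex u < toLex v := by
  rcases lt_trichotomy (toLex u) (toLex v) with h' | h' | h'
  · exact h'
  · rw [toLex_inj.1 h'] at h
    exact absurd h (lt_irrefl _)
  · exact absurd h (toLex_doubleExpand_lt hb hodd hv hu h').not_gt

lemma shift_doubleExpand (hb : 1 < b) (hodd : Odd b) (hv : IsOver b v) {j : ℕ} (hj : Even j) :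
    shift (blockPos (expand b 1 v) (blockPos v j)) (doubleExpand b v) =
      doubleExpand b (shift j v) := by
  rw [doubleExpand, shift_expand 0 (expand_pos hb 1 v),
    expand_add_even 0 ((even_blockPos hodd hv j).2 hj), shift_expand 1 (hv.pos hb),
    expand_add_even 1 hj, doubleExpand]

/-- Keeping only the last letter of block `j` of the intermediate word drops `b - 1` letters, an
even number, so the starting letter of the outer expansion is still `1`. -/
lemma shift_doubleExpand_of_eq (hb : 1 < b) (hodd : Odd b) (hv : IsOver b v) {j : ℕ}
    (hj : Even j) (hvj : v j = b) :
    shift (blockPos (expand b 1 v) (blockPos v j + (b - 1))) (doubleExpand b v) =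
      doubleExpand b (Function.update (shift j v) 0 1) := by
  have he : Even (blockPos v j + (b - 1)) :=
    ((even_blockPos hodd hv j).2 hj).add (Nat.Odd.sub_odd hodd odd_one)
  rw [doubleExpand, shift_expand 0 (expand_pos hb 1 v), expand_add_even 0 he,
    shift_expand_add 1 (hv.pos hb) (by omega), expand_add_even 1 hj, doubleExpand, hvj,
    Nat.sub_sub_self hb.le]

/-! ### Fixed points of the double expansion -/

lemma isOver_doubleExpand (b : ℕ) (v : InfiniteWord) : IsOver b (doubleExpand b v) :=
  isOver_expand b 0 _

lemma exists_doubleExpand_eq_self (hb : 1 < b) : ∃ m, doubleExpand b m = m := by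
  have hover : ∀ n, IsOver b ((doubleExpand b)^[n] fun _ => 1) := by
    intro n
    rcases n with _ | n
    · exact fun _ => Or.inl rfl
    · rw [Function.iterate_succ_apply']
      exact isOver_doubleExpand b _
  have hstep : ∀ n, ∀ i < n + 1, (doubleExpand b)^[n + 1] (fun _ => 1) i =
      (doubleExpand b)^[n + 1 + 1] (fun _ => 1) i := by
    intro n
    induction n with
    | zero =>
      intro i hi
      rw [Function.iterate_succ_apply', Function.iterate_succ_apply']
      exact doubleExpand_congr hb (hover 0) (hover 1) (n := 0) (by simp) hi
    | succ n ih =>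
      intro i hi
      rw [Function.iterate_succ_apply', Function.iterate_succ_apply' _ (n + 1 + 1)]
      exact doubleExpand_congr hb (hover _) (hover _) ih hi
  have hstable : ∀ i d, (doubleExpand b)^[i + 1 + d] (fun _ => 1) i =
      (doubleExpand b)^[i + 1] (fun _ => 1) i := by
    intro i d
    induction d with
    | zero => rfl
    | succ d ih =>
      rw [← ih]
      have := hstep (i + d) i (by omega)
      rw [show i + 1 + (d + 1) = i + d + 1 + 1 by omega, show i + 1 + d = i + d + 1 by omega, this]
  -- The fixed point is the diagonal limit: letter `i` is stable from iterate `i + 1` on.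
  refine ⟨fun i => (doubleExpand b)^[i + 1] (fun _ => 1) i, funext fun n => ?_⟩
  have h := doubleExpand_congr hb (u := fun i => (doubleExpand b)^[i + 1] (fun _ => 1) i)
    (v := (doubleExpand b)^[n + 1] fun _ => 1) (fun i => hover (i + 1) i) (hover (n + 1)) (n := n)
    (fun i hi => by
      have := hstable i (n - i)
      rw [show i + 1 + (n - i) = n + 1 by omega] at this
      exact this.symm) (Nat.lt_succ_self n)
  rw [h, ← Function.iterate_succ_apply' (doubleExpand b)]
  exact hstable n 1

lemma isOver_of_doubleExpand_eq (hm : doubleExpand b m = m) : IsOver b m :=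
  hm ▸ isOver_doubleExpand b m

/-- A family of words closed under inverting the double expansion consists of the fixed point. -/
lemma eq_of_doubleExpand_invariant (hb : 1 < b) (hm : doubleExpand b m = m)
    {P : InfiniteWord → Prop} (hP : ∀ w, P w → ∃ v, P v ∧ IsOver b v ∧ w = doubleExpand b v)
    (hw : P w) : w = m := by
  have key : ∀ n, ∀ w, P w → ∀ i < n, w i = m i := by
    intro n
    induction n with
    | zero => simp
    | succ n ih =>
      intro w hw i hi
      obtain ⟨v, hv, hvo, rfl⟩ := hP w hw
      rw [doubleExpand_congr hb hvo (isOver_of_doubleExpand_eq hm) (ih v hv) hi, hm]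
  exact funext fun n => key (n + 1) w hw n (Nat.lt_succ_self n)

lemma runLength_of_doubleExpand_eq (hb : 1 < b) (hm : doubleExpand b m = m) :
    runLength m = expand b 1 m := by
  conv_lhs => rw [← hm]
  exact runLength_doubleExpand hb m

lemma iterate_runLength_of_doubleExpand_eq (hb : 1 < b) (hm : doubleExpand b m = m) (k : ℕ) :
    runLength^[k] m = if Even k then m else expand b 1 m := by
  induction k with
  | zero => simp
  | succ k ih =>
    rw [Function.iterate_succ_apply', ih]
    by_cases hk : Even k
    · rw [if_pos hk, if_neg (by rwa [Nat.even_add_one, not_not]),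
        runLength_of_doubleExpand_eq hb hm]
    · rw [if_neg hk, if_pos (by rwa [Nat.even_add_one]),
        runLength_expand hb 1 ((isOver_of_doubleExpand_eq hm).pos hb)]

lemma isSmooth_of_doubleExpand_eq (hb : 1 < b) (hm : doubleExpand b m = m) : IsSmooth 1 b m := by
  have hover := isOver_of_doubleExpand_eq hm
  intro k
  rw [iterate_runLength_of_doubleExpand_eq hb hm]
  split_ifs
  · refine ⟨?_, hover⟩
    have := hasInfinitelyManyBlocks_expand hb 0 (expand_pos hb 1 m)
    rwa [← doubleExpand, hm] at this
  · exact ⟨hasInfinitelyManyBlocks_expand hb 1 (hover.pos hb), isOver_expand b 1 m⟩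

lemma apply_of_lt_of_doubleExpand_eq (hb : 1 < b) (hm : doubleExpand b m = m) {r : ℕ}
    (hr : r < b) : m r = 1 := by
  rw [← hm]
  exact doubleExpand_of_lt hb (isOver_of_doubleExpand_eq hm) hr

lemma phi_of_doubleExpand_eq (hb : 1 < b) (hm : doubleExpand b m = m) :
    Phi m = alternating 1 b := by
  funext k
  rw [Phi, iterate_runLength_of_doubleExpand_eq hb hm, alternating]
  split_ifs
  · exact apply_of_lt_of_doubleExpand_eq hb hm (by omega)
  · exact expand_one_zero hb (isOver_of_doubleExpand_eq hm)

/-! ### Smooth words -/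

lemma phi_runLength (w : InfiniteWord) (k : ℕ) : Phi (runLength w) k = Phi w (k + 1) := rfl

lemma IsSmooth.eq_doubleExpand (h : IsSmooth 1 b w) (h0 : Phi w 0 = 1) (h1 : Phi w 1 = b) :
    w = doubleExpand b (InfiniteWord.runLength (InfiniteWord.runLength w)) := by
  rw [doubleExpand, ← h.runLength.eq_expand (p := 1), ← h.eq_expand (p := 0)]
  · rw [letter_of_even (by simp)]; exact h0
  · rw [letter_of_odd (by simp)]; exact h1

lemma IsSmooth.eq_of_phi_eq (hb : 1 < b) (hm : doubleExpand b m = m) (hw : IsSmooth 1 b w)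
    (hphi : Phi w = alternating 1 b) : w = m := by
  refine eq_of_doubleExpand_invariant hb hm
    (P := fun w => IsSmooth 1 b w ∧ Phi w = alternating 1 b) ?_ ⟨hw, hphi⟩
  rintro w ⟨hw, hphi⟩
  refine ⟨InfiniteWord.runLength (InfiniteWord.runLength w), ⟨hw.runLength.runLength, ?_⟩,
    hw.runLength.runLength.isOver, hw.eq_doubleExpand (by rw [hphi]; rfl) (by rw [hphi]; simp [alternating])⟩
  funext k
  rw [phi_runLength, phi_runLength, hphi]
  simp [alternating, Nat.even_add]

lemma IsSmooth.apply_one (hb : 1 < b) (h : IsSmooth 1 b w) (h0 : w 0 = 1) (h1 : Phi w 1 = 1) :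
    w 1 = b := by
  have h1' : InfiniteWord.runLength w 0 = 1 := h1
  have := expand_blockPos b 0 (h.runLength.isOver.pos hb) 1
  rwa [blockPos_one, h1', ← h.eq_expand (by rw [h0, letter_of_even (by simp)]),
    letter_of_odd (by simp)] at this

lemma isMinimalSmooth_of_doubleExpand_eq (hb : 1 < b) (hodd : Odd b)
    (hm : doubleExpand b m = m) : IsMinimalSmooth 1 b m := by
  refine ⟨isSmooth_of_doubleExpand_eq hb hm, fun w hw => ?_⟩
  have hover := isOver_of_doubleExpand_eq hm
  suffices ∀ k w, IsSmooth 1 b w → ¬ LTAt k w m by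
    refine not_lt.1 fun h => ?_
    obtain ⟨k, hk⟩ := toLex_lt_iff.1 h
    exact this k w hw hk
  intro k
  induction k using Nat.strong_induction_on with
  | _ k ih =>
    intro w hw hlt
    have hm0 := apply_of_lt_of_doubleExpand_eq hb hm (r := 0) (by omega)
    have hm1 := apply_of_lt_of_doubleExpand_eq hb hm (r := 1) hb
    have hw0 : w 0 = 1 := by
      rcases hw.isOver 0 with h | h
      · exact h
      · obtain ⟨heq, hlt⟩ := hlt
        rcases k with _ | k
        · omega
        · have := heq 0 (by omega); omega
    have hw1 : Phi w 1 = b := by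
      rcases hw.runLength.isOver 0 with h | h
      · have h1 := hw.apply_one hb hw0 h
        obtain ⟨heq, hlt⟩ := hlt
        rcases k with _ | _ | k
        · omega
        · rw [zero_add] at hlt; omega
        · have := heq 1 (by omega); omega
      · exact h
    have hE := hw.eq_doubleExpand hw0 hw1
    have hvs := hw.runLength.runLength
    obtain ⟨l, hl⟩ : ∃ l, LTAt l (runLength (runLength w)) m := by
      refine toLex_lt_iff.1 (toLex_lt_of_doubleExpand_lt hb hodd hvs.isOver hover ?_)
      rw [← hE, hm]
      exact ⟨k, hlt⟩
    obtain ⟨l', hl', hlt'⟩ := hl.doubleExpand hb hodd hvs.isOver hover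
    rw [← hE, hm] at hlt'
    -- Both are the first position where `w` and `m` differ, so `l < k` and the descent continues.
    have : l' = k := by
      rcases lt_trichotomy l' k with h | h | h
      · exact absurd (hlt.1 _ h) hlt'.2.ne
      · exact h
      · exact absurd (hlt'.1 _ h) hlt.2.ne
    exact ih l (by omega) _ hvs hl

/-! ### Lyndon words -/

lemma isLyndon_iff : IsLyndon w ↔ ∀ n, 0 < n → toLex w < toLex (shift n w) := Iff.rfl

/-- A suffix that is not larger than the word starts with a full block `1^b`. -/
lemma lt_shift_or (hb : 1 < b) (hu : IsOver b u) (h0 : u 0 = b) (n : ℕ) :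
    toLex (expand b 0 u) < toLex (shift n (expand b 0 u)) ∨
      ∃ i, Even i ∧ u i = b ∧ n = blockPos u i := by
  have hpos := hu.pos hb
  obtain ⟨i, r, hr, rfl⟩ := exists_block hpos n
  have hfirst : ∀ r < b, expand b 0 u r = 1 := fun r hr => by
    rw [expand_of_lt b 0 hpos (by rwa [h0]), letter_of_even (by simp)]
  by_cases hi : Even i
  · by_cases hfull : r = 0 ∧ u i = b
    · exact Or.inr ⟨i, hi, hfull.2, by rw [hfull.1, add_zero]⟩
    · left
      have hlt : u i - r < b := by rcases hu i with h | h <;> omega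
      -- Fewer than `b` ones remain in the block, so the suffix reaches `b` while the word still
      -- reads `1`.
      refine ⟨u i - r, fun k hk => ?_, ?_⟩
      · change expand b 0 u k = expand b 0 u (blockPos u i + r + k)
        rw [hfirst k (by omega), add_assoc, expand_apply b 0 hpos (by omega),
          letter_of_even (by rwa [zero_add])]
      · change expand b 0 u (u i - r) < expand b 0 u (blockPos u i + r + (u i - r))
        rw [hfirst _ hlt, add_assoc, Nat.add_sub_of_le hr.le, ← blockPos_succ,
          expand_blockPos b 0 hpos, letter_of_odd (by rwa [zero_add, Nat.even_add_one, not_not])]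
        exact hb
  · left
    refine ⟨0, by simp, ?_⟩
    change expand b 0 u 0 < expand b 0 u (blockPos u i + r + 0)
    rw [hfirst 0 (by omega), add_zero, expand_apply b 0 hpos hr,
      letter_of_odd (by rwa [zero_add])]
    exact hb

/-- A letter `b` at an even position lies in an odd block, which starts at an odd position and so
has length `b`. That length sits in an even block `j` of `m`, which by induction has length `1`,
making its only position even, a contradiction. -/
lemma apply_even_of_doubleExpand_eq (hb : 1 < b) (hodd : Odd b) (hm : doubleExpand b m = m)
    {n : ℕ} (hn : Even n) : m n = 1 := by
  have hover := isOver_of_doubleExpand_eq hm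
  have hupos := expand_pos hb 1 m
  induction n using Nat.strong_induction_on with
  | _ n ih =>
    refine (hover n).resolve_right fun hmn => ?_
    obtain ⟨i, r, hr, rfl⟩ := exists_block hupos n
    have hi : ¬ Even i := by
      have h := expand_apply b 0 hupos hr
      rw [← doubleExpand, hm, hmn, zero_add] at h
      exact odd_of_letter_eq hb h.symm
    have hSi : ¬ Even (blockPos (expand b 1 m) i) := by
      rwa [even_blockPos hodd (isOver_expand b 1 m)]
    have hr0 : 0 < r := by
      rcases r with _ | r
      · exact absurd hn hSi
      · omega
    have hle := le_blockPos hupos i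
    have hui : expand b 1 m i = b := by
      rcases isOver_expand b 1 m i with h | h
      · omega
      · exact h
    obtain ⟨j, s, hs, rfl⟩ := exists_block (hover.pos hb) i
    rw [expand_apply b 1 (hover.pos hb) hs] at hui
    have hj : Even j := by
      have := odd_of_letter_eq hb hui
      rw [Nat.even_add] at this
      simpa using this
    have hjle := le_blockPos (hover.pos hb) j
    have hmj := ih j (by omega) hj
    have hs0 : s = 0 := by omega
    rw [hs0, add_zero, even_blockPos hodd hover] at hi
    exact hi hj

lemma isLyndon_of_doubleExpand_eq (hb : 1 < b) (hodd : Odd b) (hm : doubleExpand b m = m) :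
    IsLyndon m := by
  have hover := isOver_of_doubleExpand_eq hm
  have hu := isOver_expand b 1 m
  rw [isLyndon_iff]
  intro n
  induction n using Nat.strong_induction_on with
  | _ n ih =>
    intro hn
    rcases lt_shift_or hb hu (expand_one_zero hb hover) n with h | ⟨i, hi, hui, rfl⟩
    · rwa [← doubleExpand, hm] at h
    · obtain ⟨j, s, hs, rfl⟩ := exists_block (hover.pos hb) i
      rw [expand_apply b 1 (hover.pos hb) hs] at hui
      have hj : Even j := by
        have := odd_of_letter_eq hb hui
        rw [Nat.even_add] at this
        simpa using this
      have hmj := apply_even_of_doubleExpand_eq hb hodd hm hj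
      obtain rfl : s = 0 := by omega
      rw [add_zero] at hn hi ⊢
      have hj0 : 0 < j := by
        rcases j with _ | j
        · exact absurd hn (lt_irrefl _)
        · omega
      have hle := le_blockPos (hover.pos hb) j
      have hlt := lt_blockPos hb hu (expand_one_zero hb hover) (n := blockPos m j) (by omega)
      have h := toLex_doubleExpand_lt hb hodd hover (hover.shift j)
        (ih j (by simp only [add_zero]; omega) hj0)
      rwa [← shift_doubleExpand hb hodd hover hj, hm] at h

/-- The fixed point is the only smooth word with the letter `1` at all even positions. -/
lemma IsSmooth.eq_of_apply_even (hb : 1 < b) (hodd : Odd b) (hm : doubleExpand b m = m)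
    (hw : IsSmooth 1 b w) (heven : ∀ n, Even n → w n = 1) : w = m := by
  refine eq_of_doubleExpand_invariant hb hm
    (P := fun w => IsSmooth 1 b w ∧ ∀ n, Even n → w n = 1) ?_ ⟨hw, heven⟩
  clear! w
  rintro w ⟨hw, heven⟩
  have hw' := hw.runLength
  have hw'' := hw'.runLength
  have hexp := hw.eq_expand (p := 0) (by rw [heven 0 (by simp), letter_of_even (by simp)])
  -- An odd block consists of letters `b` and starts at an odd position; length `b` would make it
  -- cover an even one.
  have hodd1 : ∀ i, ¬ Even i → InfiniteWord.runLength w i = 1 := by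
    intro i hi
    refine (hw'.isOver i).resolve_right fun h => ?_
    have h1 := heven (blockPos (InfiniteWord.runLength w) i + 1)
      (by rwa [Nat.even_add_one, even_blockPos hodd hw'.isOver])
    rw [hexp, runLength_expand hb 0 (hw'.isOver.pos hb),
      expand_apply b 0 (hw'.isOver.pos hb) (by omega)] at h1
    exact hi (by simpa using even_of_letter_eq_one hb h1)
  have h1 : Phi w 1 = b := by
    refine (hw'.isOver 0).resolve_left fun h => ?_
    have hexp' := hw'.eq_expand (p := 0) (by rw [h, letter_of_even (by simp)])
    have hpos := hw''.isOver.pos hb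
    have h2 := hodd1 (blockPos (InfiniteWord.runLength (InfiniteWord.runLength w)) 1)
      (by rw [even_blockPos hodd hw''.isOver]; simp)
    rw [hexp', runLength_expand hb 0 hpos, expand_blockPos b 0 hpos,
      letter_of_odd (by simp)] at h2
    omega
  have hE := hw.eq_doubleExpand (heven 0 (by simp)) h1
  refine ⟨_, ⟨hw'', fun n hn => ?_⟩, hw''.isOver, hE⟩
  refine (hw''.isOver n).resolve_right fun h => ?_
  have hpos := hw''.isOver.pos hb
  have hexp' := hw'.eq_expand (p := 1) (by rw [letter_of_odd (by simp)]; exact h1)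
  have h2 := hodd1 (blockPos (InfiniteWord.runLength (InfiniteWord.runLength w)) n + 1)
    (by rw [Nat.even_add_one, even_blockPos hodd hw''.isOver, not_not]; exact hn)
  rw [hexp', runLength_expand hb 1 hpos, expand_apply b 1 hpos (by omega)] at h2
  have := even_of_letter_eq_one hb h2
  rw [Nat.even_add] at this
  simp [hn] at this

/-- The fixed point starts with `1^b b 1^b`; this is the part after the first block. -/
lemma apply_of_le_of_doubleExpand_eq (hb : 1 < b) (hodd : Odd b) (hm : doubleExpand b m = m) :
    m b = b ∧ ∀ r < b, m (b + 1 + r) = 1 := by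
  have hover := isOver_of_doubleExpand_eq hm
  have hb3 : 3 ≤ b := by
    obtain ⟨k, rfl⟩ := hodd
    omega
  have hS : ∀ i ≤ 3, blockPos m i = i := by
    intro i hi
    induction i with
    | zero => rfl
    | succ i ih =>
      rw [blockPos_succ, ih (by omega), apply_of_lt_of_doubleExpand_eq hb hm (by omega)]
  have hu : ∀ i ≤ 2, expand b 1 m i = letter b (1 + i) := by
    intro i hi
    have := expand_blockPos b 1 (hover.pos hb) i
    rwa [hS i (by omega)] at this
  have hupos := expand_pos hb 1 m
  have hu0 : expand b 1 m 0 = b := expand_one_zero hb hover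
  have hu1 : expand b 1 m 1 = 1 := by rw [hu 1 (by omega)]; rfl
  have hu2 : expand b 1 m 2 = b := by rw [hu 2 (by omega)]; rfl
  constructor
  · have h := expand_blockPos b 0 hupos 1
    rw [blockPos_one, hu0, ← doubleExpand, hm] at h
    rw [h]; rfl
  · intro r hr
    have h := expand_apply b 0 hupos (i := 2) (r := r) (by rwa [hu2])
    rw [blockPos_succ, blockPos_one, hu0, hu1, ← doubleExpand, hm] at h
    rw [h]; rfl

/-- Some suffix of `expand b 0 m` starting with `b` becomes smaller than the whole word when its
first letter is replaced by `1`. -/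
lemma exists_update_shift_expand_lt (hb : 1 < b) (hodd : Odd b) (hm : doubleExpand b m = m) :
    ∃ j, Even j ∧ expand b 0 m j = b ∧
      toLex (Function.update (shift j (expand b 0 m)) 0 1) < toLex (expand b 0 m) := by
  have hover := isOver_of_doubleExpand_eq hm
  have hpos := hover.pos hb
  obtain ⟨hmb, hmr⟩ := apply_of_le_of_doubleExpand_eq hb hodd hm
  have hS : ∀ i ≤ b, blockPos m i = i := by
    intro i hi
    induction i with
    | zero => rfl
    | succ i ih =>
      rw [blockPos_succ, ih (by omega), apply_of_lt_of_doubleExpand_eq hb hm (by omega)]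
  have hS' : ∀ i ≤ b, blockPos m (b + 1 + i) = b + b + i := by
    intro i hi
    induction i with
    | zero => rw [add_zero, blockPos_succ, hS b le_rfl, hmb]; rfl
    | succ i ih => rw [← add_assoc, blockPos_succ, ih (by omega), hmr i (by omega)]; rfl
  have hnb : ¬ Even b := by simpa using hodd
  have hv : ∀ i ≤ b, expand b 0 m i = letter b i := by
    intro i hi
    have := expand_blockPos b 0 hpos i
    rwa [hS i hi, zero_add] at this
  have hvb : ∀ r < b, expand b 0 m (b + r) = b := by
    intro r hr
    have := expand_apply b 0 hpos (i := b) (r := r) (by rwa [hmb])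
    rwa [hS b le_rfl, zero_add, letter_of_odd hnb] at this
  have hv' : ∀ i ≤ b, expand b 0 m (b + b + i) = letter b i := by
    intro i hi
    have := expand_blockPos b 0 hpos (b + 1 + i)
    rwa [hS' i hi, zero_add, add_comm (b + 1) i,
      letter_add_even _ (by simpa [Nat.even_add_one] using hnb)] at this
  have hx : ∀ i ≤ b + 1, Function.update (shift (b + (b - 2)) (expand b 0 m)) 0 1 i =
      letter b i := by
    intro i hi
    rcases i with _ | _ | i
    · rfl
    · rw [zero_add, Function.update_of_ne (by omega), shift, add_assoc, hvb _ (by omega)]; rfl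
    · rw [Function.update_of_ne (by omega), shift,
        show b + (b - 2) + (i + 1 + 1) = b + b + i by omega, hv' i (by omega)]
      exact (letter_add_even i even_two).symm
  -- The word starts with `1b1b⋯1`, of length `b`, then `b^b`, then `1b1b⋯`. Position `2b - 2` is
  -- the last but one letter of `b^b`; turning it into `1` yields an alternating word past index
  -- `b`, whereas the original has `bb` at `b`, `b + 1`.
  refine ⟨b + (b - 2), ?_, hvb _ (by omega), b + 1, fun i hi => ?_, ?_⟩
  · rw [show b + (b - 2) = 2 * (b - 1) by omega]
    exact even_two_mul _
  · exact (hx i (by omega)).trans (hv i (by omega)).symm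
  · change Function.update (shift (b + (b - 2)) (expand b 0 m)) 0 1 (b + 1) < expand b 0 m (b + 1)
    rw [hx _ le_rfl, hvb 1 hb, letter_of_even (by rwa [Nat.even_add_one])]
    exact hb

lemma IsLyndon.lt_shift_of_even (hb : 1 < b) (hodd : Odd b) (hv : IsOver b v)
    (h : IsLyndon (doubleExpand b v)) {j : ℕ} (hj : Even j) (hj0 : 0 < j) :
    toLex v < toLex (shift j v) := by
  refine toLex_lt_of_doubleExpand_lt hb hodd hv (hv.shift j) ?_
  rw [← shift_doubleExpand hb hodd hv hj]
  have h1 := le_blockPos (hv.pos hb) j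
  have h2 := le_blockPos (expand_pos hb 1 v) (blockPos v j)
  exact h _ (by omega)

lemma IsLyndon.lt_update_shift (hb : 1 < b) (hodd : Odd b) (hv : IsOver b v)
    (h : IsLyndon (doubleExpand b v)) {j : ℕ} (hj : Even j) (hvj : v j = b) :
    toLex v < toLex (Function.update (shift j v) 0 1) := by
  refine toLex_lt_of_doubleExpand_lt hb hodd hv (hv.shift j).update_one ?_
  rw [← shift_doubleExpand_of_eq hb hodd hv hj hvj]
  have h2 := le_blockPos (expand_pos hb 1 v) (blockPos v j + (b - 1))
  exact h _ (by omega)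

lemma IsSmooth.eq_of_isLyndon (hb : 1 < b) (hodd : Odd b) (hm : doubleExpand b m = m)
    (hw : IsSmooth 1 b w) (hL : IsLyndon w) (h0 : Phi w 0 = 1) (h1 : Phi w 1 = b) : w = m := by
  refine eq_of_doubleExpand_invariant hb hm
    (P := fun w => IsSmooth 1 b w ∧ IsLyndon w ∧ Phi w 0 = 1 ∧ Phi w 1 = b) ?_ ⟨hw, hL, h0, h1⟩
  clear! w
  rintro w ⟨hw, hL, h0, h1⟩
  have hE := hw.eq_doubleExpand h0 h1
  have hv := hw.runLength.runLength
  set v := InfiniteWord.runLength (InfiniteWord.runLength w)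
  have hover := hv.isOver
  rw [hE] at hL
  have hv0 : v 0 = 1 := by
    refine (hover 0).resolve_right fun h => ?_
    -- With `j = 0`, lowering the first letter of `v` to `1` would give a smaller word.
    refine (hL.lt_update_shift hb hodd hover (j := 0) (by simp) h).not_gt ?_
    refine ⟨0, by simp, ?_⟩
    change Function.update (shift 0 v) 0 1 0 < v 0
    rw [Function.update_self, h]
    exact hb
  have hexp := hv.eq_expand (p := 0) (by rw [hv0, letter_of_even (by simp)])
  have hz := hv.runLength
  have hzpos := hz.isOver.pos hb
  have hv1 : Phi v 1 = b := by
    refine (hz.isOver 0).resolve_left fun hz0 => ?_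
    have hv1 := hv.apply_one hb hv0 hz0
    have hzm : InfiniteWord.runLength v = m := by
      refine hz.eq_of_apply_even hb hodd hm fun n hn => ?_
      refine (hz.isOver n).resolve_right fun hzn => ?_
      have hn0 : 0 < n := by
        rcases n with _ | n
        · omega
        · omega
      have hle := le_blockPos hzpos n
      refine (hL.lt_shift_of_even hb hodd hover ((even_blockPos hodd hz.isOver n).2 hn)
        (by omega)).not_gt ?_
      have hone : ∀ r < b, v (blockPos (InfiniteWord.runLength v) n + r) = 1 := by
        intro r hr
        have := expand_apply b 0 hzpos (i := n) (r := r) (by rwa [hzn])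
        rwa [← hexp, letter_of_even (by rwa [zero_add])] at this
      -- Here `v` starts with `1b`, so a suffix starting with `11` is smaller.
      refine ⟨1, fun i hi => ?_, ?_⟩
      · obtain rfl : i = 0 := by omega
        exact (hone 0 (by omega)).trans hv0.symm
      · change v (blockPos (InfiniteWord.runLength v) n + 1) < v 1
        rw [hone 1 hb, hv1]
        exact hb
    rw [hzm] at hexp
    obtain ⟨j, hj, hvj, hlt⟩ := exists_update_shift_expand_lt hb hodd hm
    rw [← hexp] at hvj hlt
    exact (hL.lt_update_shift hb hodd hover hj hvj).not_gt hlt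
  refine ⟨v, ⟨hv, fun n hn => ?_, hv0, hv1⟩, hover, hE⟩
  rcases lt_shift_or hb hz.isOver hv1 n with h | ⟨i, hi, -, rfl⟩
  · rwa [← hexp] at h
  · exact hL.lt_shift_of_even hb hodd hover ((even_blockPos hodd hz.isOver i).2 hi) hn

end InfiniteWord

theorem proposition27 (b : ℕ) (hb : 1 < b) (hodd : Odd b) :
    ∃ m : InfiniteWord,
      InfiniteWord.IsMinimalSmooth 1 b m ∧
      (∀ w : InfiniteWord,
        (InfiniteWord.IsSmooth 1 b w ∧
          InfiniteWord.Phi w = InfiniteWord.alternating 1 b) ↔ w = m) ∧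
      (∀ w : InfiniteWord,
        (InfiniteWord.IsSmooth 1 b w ∧ InfiniteWord.IsLyndon w ∧
          InfiniteWord.Phi w 0 = 1 ∧ InfiniteWord.Phi w 1 = b) ↔ w = m) := by
  obtain ⟨m, hm⟩ := InfiniteWord.exists_doubleExpand_eq_self hb
  have hsmooth := InfiniteWord.isSmooth_of_doubleExpand_eq hb hm
  have hphi := InfiniteWord.phi_of_doubleExpand_eq hb hm
  refine ⟨m, InfiniteWord.isMinimalSmooth_of_doubleExpand_eq hb hodd hm, fun w => ⟨?_, ?_⟩,
    fun w => ⟨?_, ?_⟩⟩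
  · rintro ⟨hw, hw'⟩
    exact hw.eq_of_phi_eq hb hm hw'
  · rintro rfl
    exact ⟨hsmooth, hphi⟩
  · rintro ⟨hw, hL, h0, h1⟩
    exact hw.eq_of_isLyndon hb hodd hm hL h0 h1
  · rintro rfl
    exact ⟨hsmooth, InfiniteWord.isLyndon_of_doubleExpand_eq hb hodd hm, by rw [hphi]; rfl,
      by rw [hphi]; simp [InfiniteWord.alternating]⟩
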